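/- Let $\mathbb{D}$ be the open unit disc, let $H^2(\mathbb{D})$ be the Hilbert space of holomorphic $f:\mathbb{D}\to\mathbb{C}$ with $\|f\|^2=\sup_{0<r<1}\frac{1}{2\pi}\int_0^{2\pi}|f(re^{i\theta})|^2\,d\theta<\infty$, and for $w\in\mathbb{D}$ let $K_w(z)=\frac{1}{1-\overline{w}z}$ be its reproducing kernel at $w$. Let $a,b,c,d\in\mathbb{C}$ with $ad-bc\neq 0$, and suppose that $\varphi(z)=\frac{az+b}{cz+d}$ is a (holomorphic) self-map of $\mathbb{D}$ with a fixed point $\eta$ on the unit circle, i.e. $|\eta|=1$ and $\varphi(\eta)=\eta$. Put $\varphi^*(z)=\frac{\overline{a}z-\overline{c}}{-\overline{b}z+\overline{d}}$ and $\psi=K_{\varphi^*(0)}$. Then the weighted composition operator $W_{\psi,\varphi}f=\psi\cdot(f\circ\varphi)$ is a bounded operator on $H^2(\mathbb{D})$, and it is normal if and only if $|b|=|c|$. -/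

import Mathlib

open Set Metric ComplexConjugate

noncomputable section

namespace HardyDisc

/-- The integral mean `(1 / 2π) ∫₀^{2π} |f (r e^{iθ})|² dθ`. -/
def sqMean (f : ℂ → ℂ) (r : ℝ) : ℝ :=
  (2 * Real.pi)⁻¹ * ∫ θ in (0 : ℝ)..(2 * Real.pi), ‖f (r * Complex.exp (θ * Complex.I))‖ ^ 2

/-- Membership in `H²` of the open unit disc: `f` is holomorphic on the disc with bounded
square integral means over the circles of radius `r`, `0 < r < 1`.  A function on the disc is
represented by its extension by zero to `ℂ`, so that equality of elements is equality on the
disc. -/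
def MemHardy (f : ℂ → ℂ) : Prop :=
  DifferentiableOn ℂ f (ball 0 1) ∧ (∀ z, z ∉ ball (0 : ℂ) 1 → f z = 0) ∧
    BddAbove (sqMean f '' Ioo 0 1)

/-- The `n`-th Taylor coefficient of `f` at the origin. -/
def taylorCoeff (f : ℂ → ℂ) (n : ℕ) : ℂ := (n.factorial : ℂ)⁻¹ * iteratedDeriv n f 0

theorem hasSum_taylorCoeff {f : ℂ → ℂ} (hf : DifferentiableOn ℂ f (ball 0 1)) {z : ℂ}
    (hz : z ∈ ball (0 : ℂ) 1) : HasSum (fun n => taylorCoeff f n * z ^ n) (f z) := by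
  refine (Complex.hasSum_taylorSeries_on_ball hf hz).congr_fun fun n => ?_
  simp [taylorCoeff]; ring

theorem summable_norm_taylorCoeff {f : ℂ → ℂ} (hf : DifferentiableOn ℂ f (ball 0 1)) {r : ℝ}
    (hr : r ∈ Ioo (0 : ℝ) 1) : Summable fun n => ‖taylorCoeff f n‖ * r ^ n := by
  have hz : (r : ℂ) ∈ ball (0 : ℂ) 1 := by
    simpa [abs_of_pos hr.1] using hr.2
  refine (hasSum_taylorCoeff hf hz).summable.norm.congr fun n => ?_
  simp [abs_of_pos hr.1]

theorem sqMean_eq_circleAverage (f : ℂ → ℂ) (r : ℝ) :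
    sqMean f r = Real.circleAverage (fun z => ‖f z‖ ^ 2) 0 r := by
  simp [sqMean, Real.circleAverage, circleMap]

theorem hasSum_sqMean {f : ℂ → ℂ} (hf : DifferentiableOn ℂ f (ball 0 1)) {r : ℝ}
    (hr : r ∈ Ioo (0 : ℝ) 1) :
    HasSum (fun n => ‖taylorCoeff f n‖ ^ 2 * r ^ (2 * n)) (sqMean f r) := by
  have hs := summable_norm_taylorCoeff hf hr
  set C := ∑' n, ‖taylorCoeff f n‖ * r ^ n with hC
  rw [hasSum_iff_tendsto_nat_of_nonneg (fun n => by have := hr.1; positivity)]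
  let p : ℕ → Polynomial ℂ := fun N =>
    ∑ n ∈ Finset.range N, Polynomial.C (taylorCoeff f n * (r : ℂ) ^ n) * Polynomial.X ^ n
  have hcoeff : ∀ N i, (p N).coeff i =
      if i ∈ Finset.range N then taylorCoeff f i * (r : ℂ) ^ i else 0 := by
    intro N i
    simp only [p, Polynomial.finsetSum_coeff, Polynomial.coeff_C_mul, Polynomial.coeff_X_pow]
    simp
  have hp : ∀ N, ∑ n ∈ Finset.range N, ‖taylorCoeff f n‖ ^ 2 * r ^ (2 * n) =
      (2 * Real.pi)⁻¹ * ∫ θ in (0 : ℝ)..(2 * Real.pi), ‖(p N).eval (circleMap 0 1 θ)‖ ^ 2 := by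
    intro N
    have h := (p N).sum_sq_norm_coeff_eq_circleAverage
    rw [Real.circleAverage, smul_eq_mul] at h
    rw [← h]
    symm
    rw [Finset.sum_subset (s₂ := Finset.range N)]
    · refine Finset.sum_congr rfl fun i hi => ?_
      rw [hcoeff, if_pos hi, norm_mul, norm_pow, Complex.norm_real, Real.norm_eq_abs,
        abs_of_pos hr.1]
      ring
    · intro i hi
      by_contra hN
      rw [Polynomial.mem_support_iff, hcoeff, if_neg hN] at hi
      exact hi rfl
    · intro i _ hi
      rw [Polynomial.notMem_support_iff.1 hi]; simp
  have heval : ∀ N θ, (p N).eval (circleMap 0 1 θ) =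
      ∑ n ∈ Finset.range N, taylorCoeff f n * (r * Complex.exp (θ * Complex.I)) ^ n := by
    intro N θ
    simp only [p, Polynomial.eval_finsetSum]
    refine Finset.sum_congr rfl fun n _ => ?_
    simp [circleMap]; ring
  simp_rw [hp]
  refine Filter.Tendsto.const_mul _ ?_
  refine intervalIntegral.tendsto_integral_filter_of_dominated_convergence (fun _ => C ^ 2)
    (.of_forall fun N => ?_) (.of_forall fun N => .of_forall fun θ _ => ?_)
    intervalIntegrable_const (.of_forall fun θ _ => ?_)
  · have hcont : Continuous fun θ : ℝ => ‖(p N).eval (circleMap 0 1 θ)‖ ^ 2 :=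
      (((p N).continuous.comp (continuous_circleMap 0 1)).norm).pow 2
    exact hcont.aestronglyMeasurable
  · rw [heval, norm_pow, norm_norm]
    gcongr
    refine (norm_sum_le _ _).trans ?_
    refine le_trans (le_of_eq ?_) (hs.sum_le_tsum (Finset.range N)
      fun n _ => mul_nonneg (norm_nonneg _) (pow_nonneg hr.1.le n))
    refine Finset.sum_congr rfl fun n _ => ?_
    rw [norm_mul, norm_pow, norm_mul, Complex.norm_exp_ofReal_mul_I, Complex.norm_real,
      Real.norm_eq_abs, abs_of_pos hr.1, mul_one]
  · simp_rw [heval]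
    have hz : (r * Complex.exp (θ * Complex.I) : ℂ) ∈ ball (0 : ℂ) 1 := by
      rw [mem_ball_zero_iff, norm_mul, Complex.norm_exp_ofReal_mul_I, Complex.norm_real,
        Real.norm_eq_abs, abs_of_pos hr.1, mul_one]
      exact hr.2
    exact ((hasSum_taylorCoeff hf hz).tendsto_sum_nat.norm).pow 2

/-- The supremum of the integral means is the sum of the squared Taylor coefficients. -/
theorem isLUB_sqMean {f : ℂ → ℂ} (hf : DifferentiableOn ℂ f (ball 0 1))
    (hs : Summable fun n => ‖taylorCoeff f n‖ ^ 2) :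
    IsLUB (sqMean f '' Ioo 0 1) (∑' n, ‖taylorCoeff f n‖ ^ 2) := by
  constructor
  · rintro _ ⟨r, hr, rfl⟩
    refine hasSum_le (fun n => ?_) (hasSum_sqMean hf hr) hs.hasSum
    exact mul_le_of_le_one_right (by positivity) (pow_le_one₀ hr.1.le hr.2.le)
  · intro M hM
    refine hs.tsum_le_of_sum_le fun s => ?_
    have hcont : Continuous fun r : ℝ => ∑ n ∈ s, ‖taylorCoeff f n‖ ^ 2 * r ^ (2 * n) := by
      fun_prop
    have hlim := (hcont.tendsto 1).mono_left (nhdsWithin_le_nhds (s := Iio 1))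
    simp only [one_pow, mul_one] at hlim
    refine le_of_tendsto hlim ?_
    filter_upwards [Ioo_mem_nhdsLT (show (0 : ℝ) < 1 by norm_num)] with r hr
    refine (sum_le_hasSum s (fun n _ => ?_) (hasSum_sqMean hf hr)).trans (hM ⟨r, hr, rfl⟩)
    have := hr.1
    positivity

theorem bddAbove_sqMean_iff {f : ℂ → ℂ} (hf : DifferentiableOn ℂ f (ball 0 1)) :
    BddAbove (sqMean f '' Ioo 0 1) ↔ Summable fun n => ‖taylorCoeff f n‖ ^ 2 := by
  refine ⟨fun ⟨M, hM⟩ => ?_, fun hs => (isLUB_sqMean hf hs).bddAbove⟩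
  refine summable_of_sum_le (c := M) (fun n => by positivity) fun s => ?_
  have hcont : Continuous fun r : ℝ => ∑ n ∈ s, ‖taylorCoeff f n‖ ^ 2 * r ^ (2 * n) := by
    fun_prop
  have hlim := (hcont.tendsto 1).mono_left (nhdsWithin_le_nhds (s := Iio 1))
  simp only [one_pow, mul_one] at hlim
  refine le_of_tendsto hlim ?_
  filter_upwards [Ioo_mem_nhdsLT (show (0 : ℝ) < 1 by norm_num)] with r hr
  refine (sum_le_hasSum s (fun n _ => ?_) (hasSum_sqMean hf hr)).trans (hM ⟨r, hr, rfl⟩)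
  have := hr.1
  positivity

theorem contDiffAt_of_differentiableOn {f : ℂ → ℂ} (hf : DifferentiableOn ℂ f (ball 0 1))
    (n : ℕ) : ContDiffAt ℂ n f 0 :=
  (hf.analyticAt (ball_mem_nhds 0 one_pos)).contDiffAt

theorem taylorCoeff_add {f g : ℂ → ℂ} (hf : DifferentiableOn ℂ f (ball 0 1))
    (hg : DifferentiableOn ℂ g (ball 0 1)) (n : ℕ) :
    taylorCoeff (f + g) n = taylorCoeff f n + taylorCoeff g n := by
  rw [taylorCoeff, iteratedDeriv_add (contDiffAt_of_differentiableOn hf n)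
    (contDiffAt_of_differentiableOn hg n), mul_add]
  rfl

theorem taylorCoeff_smul {f : ℂ → ℂ} (k : ℂ) (hf : DifferentiableOn ℂ f (ball 0 1)) (n : ℕ) :
    taylorCoeff (k • f) n = k * taylorCoeff f n := by
  rw [taylorCoeff, iteratedDeriv_const_smul (contDiffAt_of_differentiableOn hf n) k, smul_eq_mul,
    taylorCoeff]
  ring

theorem memlp_iff (u : ℕ → ℂ) : Memℓp u 2 ↔ Summable fun n => ‖u n‖ ^ 2 := by
  rw [memℓp_gen_iff (by norm_num)]; norm_num

/-- `H²` as a complex vector space of functions. -/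
def hardySubmodule : Submodule ℂ (ℂ → ℂ) where
  carrier := {f | MemHardy f}
  zero_mem' := by
    refine ⟨differentiableOn_const 0, fun _ _ => rfl, 0, ?_⟩
    rintro _ ⟨r, -, rfl⟩
    simp [sqMean]
  add_mem' := by
    rintro f g ⟨hf, hf0, hfb⟩ ⟨hg, hg0, hgb⟩
    refine ⟨hf.add hg, fun z hz => by simp [hf0 z hz, hg0 z hz], ?_⟩
    rw [bddAbove_sqMean_iff hf, ← memlp_iff] at hfb
    rw [bddAbove_sqMean_iff hg, ← memlp_iff] at hgb
    rw [bddAbove_sqMean_iff (hf.add hg), ← memlp_iff]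
    convert hfb.add hgb using 1
    funext n
    exact taylorCoeff_add hf hg n
  smul_mem' := by
    rintro k f ⟨hf, hf0, hfb⟩
    refine ⟨hf.const_smul k, fun z hz => by simp [hf0 z hz], ?_⟩
    rw [bddAbove_sqMean_iff hf, ← memlp_iff] at hfb
    rw [bddAbove_sqMean_iff (hf.const_smul k), ← memlp_iff]
    convert hfb.const_smul k using 1
    funext n
    exact taylorCoeff_smul k hf n

end HardyDisc

open HardyDisc

/-- The Hardy–Hilbert space `H²` of the open unit disc. -/
def HardySpace : Type := hardySubmodule

namespace HardySpace

instance : AddCommGroup HardySpace := inferInstanceAs (AddCommGroup hardySubmodule)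

instance : Module ℂ HardySpace := inferInstanceAs (Module ℂ hardySubmodule)

instance : CoeFun HardySpace fun _ => ℂ → ℂ := ⟨Subtype.val⟩

/-- The sequence of Taylor coefficients, as a linear map from `H²` to `ℓ²`. -/
def coeff : HardySpace →ₗ[ℂ] lp (fun _ : ℕ => ℂ) 2 where
  toFun f := ⟨taylorCoeff f, (memlp_iff _).2 ((bddAbove_sqMean_iff f.2.1).1 f.2.2.2)⟩
  map_add' f g := by
    ext n
    exact taylorCoeff_add f.2.1 g.2.1 n
  map_smul' k f := by
    ext n
    exact taylorCoeff_smul k f.2.1 n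

theorem coeff_injective : Function.Injective coeff := by
  intro f g h
  refine Subtype.ext (funext fun z => ?_)
  by_cases hz : z ∈ ball (0 : ℂ) 1
  · have hfg : taylorCoeff f = taylorCoeff g := congrArg Subtype.val h
    have hf := hasSum_taylorCoeff f.2.1 hz
    have hg := hasSum_taylorCoeff g.2.1 hz
    rw [hfg] at hf
    exact hf.unique hg
  · rw [f.2.2.1 z hz, g.2.2.1 z hz]

theorem coeff_surjective : Function.Surjective coeff := by
  intro u
  let p : FormalMultilinearSeries ℂ ℂ ℂ := FormalMultilinearSeries.ofScalars ℂ (u : ℕ → ℂ)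
  have hrad : (1 : ENNReal) ≤ p.radius := by
    have h := p.le_radius_of_bound (r := 1) ‖u‖ fun n => by
      have h1 : ‖p n‖ = ‖u n‖ := FormalMultilinearSeries.ofScalars_norm ..
      rw [h1]
      simpa using lp.norm_apply_le_norm (by norm_num) u n
    simpa using h
  have hps : HasFPowerSeriesOnBall p.sum p 0 p.radius :=
    p.hasFPowerSeriesOnBall (lt_of_lt_of_le one_pos hrad)
  have hdiff : DifferentiableOn ℂ p.sum (ball 0 1) := by
    refine hps.differentiableOn.mono ?_
    have h := Metric.eball_subset_eball (x := (0 : ℂ)) hrad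
    simpa [← ENNReal.ofReal_one, Metric.eball_ofReal] using h
  let f : ℂ → ℂ := (ball (0 : ℂ) 1).indicator p.sum
  have heq : EqOn f p.sum (ball 0 1) := fun z hz => indicator_of_mem hz _
  have hfd : DifferentiableOn ℂ f (ball 0 1) := hdiff.congr heq
  have hco : taylorCoeff f = u := by
    funext n
    have hev : f =ᶠ[nhds 0] p.sum := heq.eventuallyEq_of_mem (ball_mem_nhds 0 one_pos)
    have h1 : iteratedDeriv n f 0 = iteratedDeriv n p.sum 0 := hev.iteratedDeriv_eq n
    have h2 := hps.factorial_smul (1 : ℂ) n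
    have h3 : p n (fun _ => (1 : ℂ)) = u n := by
      simp [p, FormalMultilinearSeries.ofScalars]
    rw [taylorCoeff, h1, iteratedDeriv_eq_iteratedFDeriv, ← h2, h3, nsmul_eq_mul, ← mul_assoc,
      inv_mul_cancel₀ (Nat.cast_ne_zero.2 (Nat.factorial_ne_zero n)), one_mul]
  refine ⟨⟨f, hfd, fun z hz => indicator_of_notMem hz _, ?_⟩, ?_⟩
  · rw [bddAbove_sqMean_iff hfd, ← memlp_iff, hco]
    exact u.2
  · exact Subtype.ext hco

/-- The norm of `H²`; by `norm_sq_eq` below, `‖f‖²` is the supremum of the integral means. -/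
instance : NormedAddCommGroup HardySpace :=
  NormedAddCommGroup.induced HardySpace (lp (fun _ : ℕ => ℂ) 2) coeff coeff_injective

/-- The inner product of `H²` that belongs to the norm. -/
instance : InnerProductSpace ℂ HardySpace := InnerProductSpace.induced coeff

/-- `H²` is isometric to `ℓ²` through Taylor coefficients. -/
def coeffEquiv : HardySpace ≃ₗᵢ[ℂ] lp (fun _ : ℕ => ℂ) 2 where
  toLinearEquiv := LinearEquiv.ofBijective coeff ⟨coeff_injective, coeff_surjective⟩
  norm_map' _ := rfl

instance : CompleteSpace HardySpace :=
  (completeSpace_congr (e := coeffEquiv.toEquiv)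
    coeffEquiv.isometry.isUniformEmbedding).2 inferInstance

theorem norm_sq_eq (f : HardySpace) : IsLUB (sqMean f '' Ioo 0 1) (‖f‖ ^ 2) := by
  have h := isLUB_sqMean f.2.1 ((bddAbove_sqMean_iff f.2.1).1 f.2.2.2)
  have h2 := lp.norm_rpow_eq_tsum (p := 2) (by norm_num) (coeff f)
  norm_num at h2
  have h3 : ‖f‖ ^ 2 = ∑' n, ‖taylorCoeff f n‖ ^ 2 := h2
  rwa [h3]

end HardySpace

/-- The function `K_w (z) = 1 / (1 - w̄ z)`, the reproducing kernel of `H²` at `w`. -/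
def hardyKernel (w z : ℂ) : ℂ := 1 / (1 - conj w * z)

/-- The linear fractional map `z ↦ (a z + b) / (c z + d)`. -/
def linFrac (a b c d z : ℂ) : ℂ := (a * z + b) / (c * z + d)

/-- The map `φ* (z) = (ā z - c̄) / (-b̄ z + d̄)` attached to `φ = linFrac a b c d`. -/
def linFracAdjoint (a b c d : ℂ) : ℂ → ℂ := linFrac (conj a) (-conj c) (-conj b) (conj d)

/-- `φ` is a holomorphic self-map of the open unit disc. -/
def IsHolomorphicSelfMap (φ : ℂ → ℂ) : Prop :=
  DifferentiableOn ℂ φ (ball 0 1) ∧ MapsTo φ (ball 0 1) (ball 0 1)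

/-- The bounded operator `W` on `H²` is the weighted composition operator `f ↦ ψ · (f ∘ φ)`. -/
def IsWeightedComposition (ψ φ : ℂ → ℂ) (W : HardySpace →L[ℂ] HardySpace) : Prop :=
  ∀ f : HardySpace, ∀ z ∈ ball (0 : ℂ) 1, W f z = ψ z * f (φ z)

end

/-! The operator is understood through its action on reproducing kernels. Pairing with `f` gives `W*
K_u = conj (ψ u) K_{φ(u)}` (`adjoint_kernel`). The weight is `ψ(z) = d / (c z + d)`, which cancels
the denominator of `φ`, so that `W K_u` is a multiple of `K_{φ*(u)}` (`weightedComposition_kernel`).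
The kernels separate points of `H²`, so `W` is normal iff the Gram matrices of `W K_u` and of `W*
K_u` agree (`isStarNormal_iff_kernel`). Both have entries `|d|²` over a polynomial in `u` and `conj
v`. The constant terms of the two polynomials agree iff `|b| = |c|`, and so do the `u conj v` terms.
Given `|b| = |c|`, the fixed point on the circle makes the linear terms agree.

Boundedness comes from Littlewood subordination (`sqMean_comp_le`): `|f|²` lies below a harmonic
function, and the mean of that function composed with `φ` is its value at `φ 0`. The weight is
bounded because `c z + d` has no zero on the closed disc. -/

namespace HardyDisc

/-! ### Poisson majorants and Littlewood subordination. -/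

/-- The Herglotz integral of `|f|²` over the circle of radius `R`; its real part is the Poisson
integral of `|f|²`. -/
noncomputable def herglotzSq (f : ℂ → ℂ) (R : ℝ) (w : ℂ) : ℂ :=
  Real.circleAverage (fun ζ => herglotzRieszKernel 0 w ζ • ((‖f ζ‖ ^ 2 : ℝ) : ℂ)) 0 R

theorem re_herglotzSq {f : ℂ → ℂ} {R : ℝ} {w : ℂ} (hR : 0 ≤ R)
    (hf : ContinuousOn f (sphere 0 R)) (hw : w ∈ ball 0 R) :
    (herglotzSq f R w).re =
      Real.circleAverage ((Complex.re ∘ herglotzRieszKernel 0 w) • fun ζ => ‖f ζ‖ ^ 2) 0 R :=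
  re_circleAverage_herglotzRieszKernel_smul (g := fun ζ => ‖f ζ‖ ^ 2)
    ((hf.norm.pow 2).circleIntegrable hR) hw

/-- Reason for the complex Herglotz integral in place of its real part: holomorphy survives
composition with `φ`, so the mean value property still applies. -/
theorem differentiableOn_herglotzSq {f : ℂ → ℂ} {R : ℝ} (hR : 0 ≤ R)
    (hf : ContinuousOn f (sphere 0 R)) : DifferentiableOn ℂ (herglotzSq f R) (ball 0 R) :=
  differentiableOn_circleAverage_herglotzRieszKernel_smul
    ((Complex.continuous_ofReal.comp_continuousOn (hf.norm.pow 2)).circleIntegrable hR)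

theorem continuousOn_re_herglotzRieszKernel {R : ℝ} {w : ℂ} (hw : w ∈ ball 0 R) :
    ContinuousOn (Complex.re ∘ herglotzRieszKernel 0 w) (sphere 0 R) := by
  have h := continuousOn_herglotzRieszKernel_sphere hw
  rw [abs_of_pos (pos_of_mem_ball hw)] at h
  exact Complex.continuous_re.comp_continuousOn h

theorem re_herglotzRieszKernel_nonneg {R : ℝ} {w ζ : ℂ} (hw : w ∈ ball 0 R)
    (hζ : ζ ∈ sphere (0 : ℂ) R) : 0 ≤ (Complex.re ∘ herglotzRieszKernel 0 w) ζ := by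
  refine le_trans ?_ (le_re_herglotzRieszKernel hζ hw)
  rw [mem_ball_iff_norm] at hw
  have := norm_nonneg (w - 0)
  exact div_nonneg (by linarith) (by linarith)

/-- The squared modulus of a holomorphic function is dominated by its Poisson integral. -/
theorem norm_sq_le_re_herglotzSq {f : ℂ → ℂ} {R : ℝ} {w : ℂ}
    (hf : DiffContOnCl ℂ f (ball 0 R)) (hw : w ∈ ball 0 R) :
    ‖f w‖ ^ 2 ≤ (herglotzSq f R w).re := by
  have hR := pos_of_mem_ball hw
  have hfs : ContinuousOn f (sphere 0 R) := hf.continuousOn_ball.mono sphere_subset_closedBall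
  have hk := continuousOn_re_herglotzRieszKernel hw
  -- Expanding `|f - f w|² ≥ 0` gives `Re g ≤ |f|²` with equality at `w`; the Poisson formula is
  -- exact for the holomorphic `g`.
  let g : ℂ → ℂ := (2 * conj (f w)) • f - fun _ => ((‖f w‖ ^ 2 : ℝ) : ℂ)
  have hg : DiffContOnCl ℂ g (ball 0 R) := (hf.const_smul _).sub diffContOnCl_const
  have hgs : ContinuousOn g (sphere 0 R) := hg.continuousOn_ball.mono sphere_subset_closedBall
  have hgw : g w = ((‖f w‖ ^ 2 : ℝ) : ℂ) := by
    simp only [g, Pi.sub_apply, Pi.smul_apply, smul_eq_mul, mul_assoc, Complex.conj_mul']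
    push_cast
    ring
  have hint : CircleIntegrable ((Complex.re ∘ herglotzRieszKernel 0 w) • g) 0 R :=
    (hk.smul hgs).circleIntegrable hR.le
  have h1 := Complex.reCLM.circleAverage_comp_comm hint
  rw [hg.circleAverage_re_herglotzRieszKernel_smul hw, hgw, Complex.reCLM_apply,
    Complex.ofReal_re] at h1
  rw [re_herglotzSq hR.le hfs hw, ← h1]
  refine Real.circleAverage_mono ?_ ((hk.smul (hfs.norm.pow 2)).circleIntegrable hR.le) ?_
  · exact (Complex.continuous_re.comp_continuousOn (hk.smul hgs)).circleIntegrable hR.le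
  · intro ζ hζ
    rw [abs_of_pos hR] at hζ
    have h2 : (g ζ).re ≤ ‖f ζ‖ ^ 2 := by
      have h3 := sq_nonneg (f ζ - f w).re
      have h4 := sq_nonneg (f ζ - f w).im
      simp only [g, Pi.sub_apply, Pi.smul_apply, Complex.sq_norm, Complex.normSq_apply]
      simp at h3 h4 ⊢
      nlinarith
    have h5 : (Complex.reCLM ∘ ((Complex.re ∘ herglotzRieszKernel 0 w) • g)) ζ =
        (Complex.re ∘ herglotzRieszKernel 0 w) ζ * (g ζ).re := by
      simp
    rw [h5]
    exact mul_le_mul_of_nonneg_left h2 (re_herglotzRieszKernel_nonneg hw hζ)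

/-- Harnack's upper bound for the Poisson kernel. -/
theorem re_herglotzSq_le {f : ℂ → ℂ} {R : ℝ} {w : ℂ}
    (hf : ContinuousOn f (sphere 0 R)) (hw : w ∈ ball 0 R) :
    (herglotzSq f R w).re ≤ (R + ‖w‖) / (R - ‖w‖) * sqMean f R := by
  have hR := pos_of_mem_ball hw
  have hk := continuousOn_re_herglotzRieszKernel hw
  rw [re_herglotzSq hR.le hf hw, sqMean_eq_circleAverage, ← smul_eq_mul,
    ← Real.circleAverage_fun_smul]
  refine Real.circleAverage_mono ((hk.smul (hf.norm.pow 2)).circleIntegrable hR.le)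
    (ContinuousOn.circleIntegrable hR.le ((hf.norm.pow 2).fun_const_smul _)) fun ζ hζ => ?_
  rw [abs_of_pos hR] at hζ
  have h := re_herglotzRieszKernel_le hζ hw
  simp only [sub_zero] at h
  simp only [Pi.smul_apply', smul_eq_mul, Function.comp, herglotzRieszKernel_def, sub_zero]
  gcongr

/-- Littlewood subordination, in the form of a bound between integral means. -/
theorem sqMean_comp_le {f φ : ℂ → ℂ} (hf : DifferentiableOn ℂ f (ball 0 1))
    (hφ : DifferentiableOn ℂ φ (ball 0 1)) (hmaps : MapsTo φ (ball 0 1) (ball 0 1)) {r : ℝ}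
    (hr : r ∈ Ioo (0 : ℝ) 1) : ∃ R ∈ Ioo (0 : ℝ) 1,
      sqMean (f ∘ φ) r ≤ (3 + ‖φ 0‖) / (1 - ‖φ 0‖) * sqMean f R := by
  have hsub : closedBall (0 : ℂ) r ⊆ ball 0 1 := closedBall_subset_ball hr.2
  have hp : ‖φ 0‖ < 1 := by simpa using hmaps (mem_ball_self one_pos)
  obtain ⟨z₀, hz₀, hmax⟩ := (isCompact_closedBall (0 : ℂ) r).exists_isMaxOn
    ⟨0, mem_closedBall_self hr.1.le⟩ (hφ.continuousOn.mono hsub).norm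
  have hz₀' : ‖φ z₀‖ < 1 := by simpa using hmaps (hsub hz₀)
  -- `R > |φ z₀|` keeps the image of the closed `r`-disc inside the `R`-disc; `R > (1 + |φ 0|) / 2`
  -- keeps the Harnack constant bounded independently of `r` and `R`.
  obtain ⟨R, hR1, hR2⟩ := exists_between (max_lt hz₀' (show (1 + ‖φ 0‖) / 2 < 1 by linarith))
  rw [max_lt_iff] at hR1
  have hR0 : 0 < R := (norm_nonneg _).trans_lt hR1.1
  have hmapsR : MapsTo φ (closedBall 0 r) (ball 0 R) := fun z hz => by
    rw [mem_ball_zero_iff]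
    exact (hmax hz).trans_lt hR1.1
  have hsubR : closedBall (0 : ℂ) R ⊆ ball 0 1 := closedBall_subset_ball hR2
  have hfR : DiffContOnCl ℂ f (ball 0 R) := (hf.mono hsubR).diffContOnCl_ball subset_rfl
  have hfs : ContinuousOn f (sphere 0 R) :=
    hf.continuousOn.mono (sphere_subset_closedBall.trans hsubR)
  have hH := differentiableOn_herglotzSq hR0.le hfs
  have hHφ : DifferentiableOn ℂ (herglotzSq f R ∘ φ) (closedBall 0 r) :=
    hH.comp (hφ.mono hsub) hmapsR
  have hHφs : ContinuousOn (herglotzSq f R ∘ φ) (sphere 0 r) :=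
    hHφ.continuousOn.mono sphere_subset_closedBall
  have hmean : Real.circleAverage (herglotzSq f R ∘ φ) 0 r = herglotzSq f R (φ 0) := by
    have h : DiffContOnCl ℂ (herglotzSq f R ∘ φ) (ball 0 |r|) := by
      rw [abs_of_pos hr.1]
      exact hHφ.diffContOnCl_ball subset_rfl
    exact h.circleAverage
  have hre := Complex.reCLM.circleAverage_comp_comm (hHφs.circleIntegrable hr.1.le)
  rw [hmean, Complex.reCLM_apply] at hre
  have hfφ : ContinuousOn (fun z => ‖(f ∘ φ) z‖ ^ 2) (sphere 0 r) :=
    ((hf.continuousOn.comp hφ.continuousOn hmaps).mono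
      (sphere_subset_closedBall.trans hsub)).norm.pow 2
  have hHre : ContinuousOn (Complex.reCLM ∘ herglotzSq f R ∘ φ) (sphere 0 r) :=
    Complex.reCLM.continuous.comp_continuousOn hHφs
  have hle : sqMean (f ∘ φ) r ≤ Real.circleAverage (Complex.reCLM ∘ herglotzSq f R ∘ φ) 0 r := by
    rw [sqMean_eq_circleAverage]
    refine Real.circleAverage_mono (hfφ.circleIntegrable hr.1.le) (hHre.circleIntegrable hr.1.le)
      fun z hz => ?_
    rw [abs_of_pos hr.1] at hz
    have h := norm_sq_le_re_herglotzSq hfR (hmapsR (sphere_subset_closedBall hz))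
    simpa only [Function.comp_apply, Complex.reCLM_apply] using h
  refine ⟨R, ⟨hR0, hR2⟩, ?_⟩
  have hw0 : φ 0 ∈ ball (0 : ℂ) R := hmapsR (mem_closedBall_self hr.1.le)
  have hw0' : ‖φ 0‖ < R := by simpa using hw0
  have hsq : 0 ≤ sqMean f R := by
    rw [sqMean_eq_circleAverage]
    exact Real.circleAverage_nonneg_of_nonneg fun _ _ => by positivity
  calc sqMean (f ∘ φ) r ≤ Real.circleAverage (Complex.reCLM ∘ herglotzSq f R ∘ φ) 0 r := hle
    _ = (herglotzSq f R (φ 0)).re := hre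
    _ ≤ (R + ‖φ 0‖) / (R - ‖φ 0‖) * sqMean f R := re_herglotzSq_le hfs hw0
    _ ≤ (3 + ‖φ 0‖) / (1 - ‖φ 0‖) * sqMean f R := by
        refine mul_le_mul_of_nonneg_right ?_ hsq
        have := norm_nonneg (φ 0)
        rw [div_le_div_iff₀ (by linarith) (by linarith)]
        nlinarith [hR1.2, sq_nonneg (1 - ‖φ 0‖)]

end HardyDisc

/-! ### Boundedness of weighted composition operators. -/

namespace HardyDisc

theorem sqMean_congr {f g : ℂ → ℂ} {r : ℝ} (hr : 0 ≤ r) (h : EqOn f g (sphere 0 r)) :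
    sqMean f r = sqMean g r := by
  rw [sqMean_eq_circleAverage, sqMean_eq_circleAverage]
  refine Real.circleAverage_congr_sphere fun z hz => ?_
  rw [abs_of_nonneg hr] at hz
  simp only [h hz]

theorem sqMean_mul_le {g f : ℂ → ℂ} {r C : ℝ} (hr : 0 ≤ r) (hg : ContinuousOn g (sphere 0 r))
    (hf : ContinuousOn f (sphere 0 r)) (hC : ∀ z ∈ sphere (0 : ℂ) r, ‖g z‖ ≤ C) :
    sqMean (fun z => g z * f z) r ≤ C ^ 2 * sqMean f r := by
  rw [sqMean_eq_circleAverage, sqMean_eq_circleAverage, ← smul_eq_mul,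
    ← Real.circleAverage_fun_smul]
  refine Real.circleAverage_mono (((hg.mul hf).norm.pow 2).circleIntegrable hr)
    (ContinuousOn.circleIntegrable hr ((hf.norm.pow 2).fun_const_smul _)) fun z hz => ?_
  rw [abs_of_nonneg hr] at hz
  simp only [norm_mul, mul_pow, smul_eq_mul]
  gcongr
  exact hC z hz

/-- A bound for the integral means of `ψ · (f ∘ φ)` when `ψ` is bounded. -/
theorem sqMean_weightedComp_le {f φ ψ : ℂ → ℂ} {C M r : ℝ}
    (hφ : DifferentiableOn ℂ φ (ball 0 1)) (hmaps : MapsTo φ (ball 0 1) (ball 0 1))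
    (hψ : DifferentiableOn ℂ ψ (ball 0 1)) (hC : ∀ z ∈ ball (0 : ℂ) 1, ‖ψ z‖ ≤ C)
    (hf : DifferentiableOn ℂ f (ball 0 1)) (hM : ∀ r ∈ Ioo (0 : ℝ) 1, sqMean f r ≤ M)
    (hr : r ∈ Ioo (0 : ℝ) 1) :
    sqMean ((ball 0 1).indicator fun z => ψ z * f (φ z)) r ≤
      C ^ 2 * ((3 + ‖φ 0‖) / (1 - ‖φ 0‖)) * M := by
  have hsub : sphere (0 : ℂ) r ⊆ ball 0 1 :=
    sphere_subset_closedBall.trans (closedBall_subset_ball hr.2)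
  have hp : ‖φ 0‖ < 1 := by simpa using hmaps (mem_ball_self one_pos)
  obtain ⟨R, hR, hle⟩ := sqMean_comp_le hf hφ hmaps hr
  rw [sqMean_congr hr.1.le fun z hz => indicator_of_mem (hsub hz) _]
  refine (sqMean_mul_le hr.1.le (hψ.continuousOn.mono hsub)
    ((hf.continuousOn.comp hφ.continuousOn hmaps).mono hsub) fun z hz => hC z (hsub hz)).trans ?_
  rw [mul_assoc]
  refine mul_le_mul_of_nonneg_left (hle.trans ?_) (sq_nonneg C)
  have h0 : 0 ≤ (3 + ‖φ 0‖) / (1 - ‖φ 0‖) :=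
    div_nonneg (by positivity) (by linarith)
  exact mul_le_mul_of_nonneg_left (hM R hR) h0

end HardyDisc

namespace HardySpace

open HardyDisc

theorem ext_ball {f g : HardySpace} (h : EqOn (f : ℂ → ℂ) g (ball 0 1)) : f = g := by
  refine Subtype.ext (funext fun z => ?_)
  by_cases hz : z ∈ ball (0 : ℂ) 1
  · exact h hz
  · rw [f.2.2.1 z hz, g.2.2.1 z hz]

theorem sqMean_le_norm_sq (f : HardySpace) {r : ℝ} (hr : r ∈ Ioo (0 : ℝ) 1) :
    sqMean f r ≤ ‖f‖ ^ 2 :=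
  (norm_sq_eq f).1 ⟨r, hr, rfl⟩

theorem norm_le_of_sqMean_le (f : HardySpace) {M : ℝ} (hM : 0 ≤ M)
    (h : ∀ r ∈ Ioo (0 : ℝ) 1, sqMean f r ≤ M ^ 2) : ‖f‖ ≤ M := by
  refine (sq_le_sq₀ (norm_nonneg _) hM).1 ((norm_sq_eq f).2 ?_)
  rintro _ ⟨r, hr, rfl⟩
  exact h r hr

/-- Weighted composition operators with bounded symbol are bounded on `H²`. -/
theorem exists_isWeightedComposition {φ ψ : ℂ → ℂ} (hφ : IsHolomorphicSelfMap φ) {C : ℝ}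
    (hψ : DifferentiableOn ℂ ψ (ball 0 1)) (hC : ∀ z ∈ ball (0 : ℂ) 1, ‖ψ z‖ ≤ C) :
    ∃ W : HardySpace →L[ℂ] HardySpace, IsWeightedComposition ψ φ W := by
  have hp : ‖φ 0‖ < 1 := by simpa using hφ.2 (mem_ball_self one_pos)
  set K : ℝ := C ^ 2 * ((3 + ‖φ 0‖) / (1 - ‖φ 0‖))
  have hK0 : 0 ≤ K :=
    mul_nonneg (sq_nonneg C) (div_nonneg (by positivity) (by linarith))
  have hbound (f : HardySpace) {r : ℝ} (hr : r ∈ Ioo (0 : ℝ) 1) :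
      sqMean ((ball 0 1).indicator fun z => ψ z * f (φ z)) r ≤ K * ‖f‖ ^ 2 :=
    sqMean_weightedComp_le hφ.1 hφ.2 hψ hC f.2.1 (fun r hr => sqMean_le_norm_sq f hr) hr
  have hmem (f : HardySpace) : MemHardy ((ball 0 1).indicator fun z => ψ z * f (φ z)) := by
    refine ⟨?_, fun z hz => indicator_of_notMem hz _, K * ‖f‖ ^ 2, ?_⟩
    · exact (hψ.mul (f.2.1.comp hφ.1 hφ.2)).congr fun z hz => indicator_of_mem hz _
    · rintro _ ⟨r, hr, rfl⟩
      exact hbound f hr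
  let T : HardySpace →ₗ[ℂ] HardySpace :=
    { toFun := fun f => ⟨_, hmem f⟩
      map_add' := fun f g => by
        refine ext_ball fun z hz => ?_
        change (ball 0 1).indicator (fun z => ψ z * (f (φ z) + g (φ z))) z =
          (ball 0 1).indicator (fun z => ψ z * f (φ z)) z +
            (ball 0 1).indicator (fun z => ψ z * g (φ z)) z
        simp only [indicator_of_mem hz]
        ring
      map_smul' := fun k f => by
        refine ext_ball fun z hz => ?_
        change (ball 0 1).indicator (fun z => ψ z * (k * f (φ z))) z =
          k * (ball 0 1).indicator (fun z => ψ z * f (φ z)) z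
        simp only [indicator_of_mem hz]
        ring }
  refine ⟨T.mkContinuous (Real.sqrt K) fun f => ?_, fun f z hz =>
    indicator_of_mem hz fun z => ψ z * f (φ z)⟩
  refine norm_le_of_sqMean_le _ (by positivity) fun r hr => ?_
  rw [mul_pow, Real.sq_sqrt hK0]
  exact hbound f hr

/-! ### Reproducing kernels and normality. -/

/-- The reproducing kernel at `w`, as an element of `H²`. -/
theorem exists_reproducingKernel {w : ℂ} (hw : w ∈ ball (0 : ℂ) 1) :
    ∃ k : HardySpace, (∀ f : HardySpace, inner ℂ k f = f w) ∧
      ∀ z ∈ ball (0 : ℂ) 1, k z = hardyKernel w z := by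
  have hw1 : ‖w‖ < 1 := by simpa using hw
  -- The Taylor coefficients `conj w ^ n` of `K_w` turn the `ℓ²` pairing with `f` into the power
  -- series of `f` at `w`.
  have hmem : Memℓp (fun n => conj w ^ n) 2 := by
    rw [memlp_iff]
    simp only [norm_pow, RCLike.norm_conj, ← pow_mul, mul_comm _ 2]
    simp only [pow_mul]
    exact summable_geometric_of_lt_one (by positivity)
      (pow_lt_one₀ (norm_nonneg _) hw1 two_ne_zero)
  obtain ⟨k, hk⟩ := coeff_surjective ⟨_, hmem⟩
  have hco : taylorCoeff k = fun n => conj w ^ n := congrArg Subtype.val hk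
  refine ⟨k, fun f => ?_, fun z hz => ?_⟩
  · have h1 : HasSum (fun n => inner ℂ (coeff k n) (coeff f n)) (inner ℂ k f) :=
      lp.hasSum_inner (coeff k) (coeff f)
    refine h1.unique ((hasSum_taylorCoeff f.2.1 hw).congr_fun fun n => ?_)
    change taylorCoeff f n * conj (taylorCoeff k n) = taylorCoeff f n * w ^ n
    simp [hco]
  · have h1 := hasSum_taylorCoeff k.2.1 hz
    have hz1 : ‖z‖ < 1 := by simpa using hz
    have h2 : HasSum (fun n => (conj w * z) ^ n) (1 - conj w * z)⁻¹ := by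
      refine hasSum_geometric_of_norm_lt_one ?_
      rw [norm_mul, RCLike.norm_conj]
      exact mul_lt_one_of_nonneg_of_lt_one_left (norm_nonneg _) hw1 hz1.le
    rw [hco] at h1
    rw [hardyKernel, one_div]
    exact h1.unique (h2.congr_fun fun n => (mul_pow ..).symm)

/-- The reproducing kernel `K_w` of `H²` for `w` in the disc, with the value `0` elsewhere. -/
noncomputable def kernel (w : ℂ) : HardySpace :=
  open Classical in
  if hw : w ∈ ball (0 : ℂ) 1 then (exists_reproducingKernel hw).choose else 0

theorem inner_kernel {w : ℂ} (hw : w ∈ ball (0 : ℂ) 1) (f : HardySpace) :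
    inner ℂ (kernel w) f = f w := by
  rw [kernel, dif_pos hw]
  exact (exists_reproducingKernel hw).choose_spec.1 f

theorem kernel_apply {w z : ℂ} (hw : w ∈ ball (0 : ℂ) 1) (hz : z ∈ ball (0 : ℂ) 1) :
    kernel w z = hardyKernel w z := by
  rw [kernel, dif_pos hw]
  exact (exists_reproducingKernel hw).choose_spec.2 z hz

theorem inner_kernel_kernel {w z : ℂ} (hw : w ∈ ball (0 : ℂ) 1) (hz : z ∈ ball (0 : ℂ) 1) :
    inner ℂ (kernel z) (kernel w) = hardyKernel w z := by
  rw [inner_kernel hz, kernel_apply hw hz]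

theorem eq_of_inner_kernel {f g : HardySpace}
    (h : ∀ u ∈ ball (0 : ℂ) 1, inner ℂ (kernel u) f = inner ℂ (kernel u) g) : f = g :=
  ext_ball fun u hu => by rw [← inner_kernel hu, ← inner_kernel hu, h u hu]

open ContinuousLinearMap in
/-- Normality is tested on the reproducing kernels. -/
theorem isStarNormal_iff_kernel (W : HardySpace →L[ℂ] HardySpace) :
    IsStarNormal W ↔ ∀ u ∈ ball (0 : ℂ) 1, ∀ v ∈ ball (0 : ℂ) 1,
      inner ℂ (W (kernel u)) (W (kernel v)) =
        inner ℂ (adjoint W (kernel u)) (adjoint W (kernel v)) := by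
  have hswap (u v : HardySpace) : inner ℂ (W u) (W v) = inner ℂ (adjoint W u) (adjoint W v) ↔
      inner ℂ ((adjoint W * W) u) v = inner ℂ ((W * adjoint W) u) v := by
    change _ ↔ inner ℂ (adjoint W (W u)) v = inner ℂ (W (adjoint W u)) v
    rw [adjoint_inner_left W v (W u), adjoint_inner_right W (adjoint W u) v]
  constructor
  · rintro ⟨h⟩ u - v -
    rw [hswap]
    exact congrArg (fun T : HardySpace →L[ℂ] HardySpace => inner ℂ (T (kernel u)) (kernel v)) h
  · intro h
    have hker (u : ℂ) (hu : u ∈ ball (0 : ℂ) 1) :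
        (adjoint W * W) (kernel u) = (W * adjoint W) (kernel u) := by
      refine eq_of_inner_kernel fun v hv => ?_
      have h1 := (hswap _ _).1 (h u hu v hv)
      rw [← inner_conj_symm, h1, inner_conj_symm]
    -- `W* W` and `W W*` are self-adjoint, so agreement on kernels passes to every `f` by moving
    -- them across the pairing with `K_u`.
    refine ⟨ContinuousLinearMap.ext fun f => eq_of_inner_kernel fun u hu => ?_⟩
    have h1 : inner ℂ ((adjoint W * W) (kernel u)) f = inner ℂ ((W * adjoint W) (kernel u)) f := by
      rw [hker u hu]
    change inner ℂ (adjoint W (W (kernel u))) f = inner ℂ (W (adjoint W (kernel u))) f at h1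
    change inner ℂ (kernel u) (adjoint W (W f)) = inner ℂ (kernel u) (W (adjoint W f))
    rw [adjoint_inner_left W f, ← adjoint_inner_right W (adjoint W (kernel u))] at h1
    rw [adjoint_inner_right W _ (W f), h1, adjoint_inner_left]
open ContinuousLinearMap in
theorem adjoint_kernel {ψ φ : ℂ → ℂ} {W : HardySpace →L[ℂ] HardySpace}
    (hW : IsWeightedComposition ψ φ W) (hφ : MapsTo φ (ball 0 1) (ball 0 1)) {u : ℂ}
    (hu : u ∈ ball (0 : ℂ) 1) : adjoint W (kernel u) = conj (ψ u) • kernel (φ u) := by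
  refine ext_inner_right ℂ fun f => ?_
  rw [adjoint_inner_left, inner_kernel hu, hW f u hu, inner_smul_left, inner_kernel (hφ hu),
    Complex.conj_conj]

end HardySpace

/-! ### Linear fractional self-maps of the disc and the map `φ*`. -/

namespace HardyDisc

variable {a b c d : ℂ}

theorem norm_num_le_norm_denom (hdet : a * d - b * c ≠ 0)
    (hself : MapsTo (linFrac a b c d) (ball 0 1) (ball 0 1)) {z : ℂ}
    (hz : z ∈ closedBall (0 : ℂ) 1) : ‖a * z + b‖ ≤ ‖c * z + d‖ := by
  -- Division by zero gives `0`, so the self-map hypothesis says nothing at a pole. The possible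
  -- pole is removed and the inequality recovered by density.
  have hcl : closure (ball (0 : ℂ) 1 ∩ {-d / c}ᶜ) ⊆ {z | ‖a * z + b‖ ≤ ‖c * z + d‖} := by
    refine closure_minimal (fun w hw => ?_) (isClosed_le (by fun_prop) (by fun_prop))
    have hden : c * w + d ≠ 0 := by
      intro h0
      by_cases hc : c = 0
      · exact hdet (by simp [hc, show d = 0 by simpa [hc] using h0])
      · refine hw.2 (mem_singleton_iff.2 ?_)
        rw [eq_div_iff hc]
        linear_combination h0
    have h1 : ‖linFrac a b c d w‖ < 1 := by simpa using hself hw.1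
    rw [linFrac, norm_div, div_lt_one (norm_pos_iff.2 hden)] at h1
    exact h1.le
  have hsub := (dense_compl_singleton (-d / c)).open_subset_closure_inter
    (isOpen_ball (x := (0 : ℂ)) (ε := 1))
  refine hcl (closure_minimal hsub isClosed_closure ?_)
  rwa [closure_ball _ one_ne_zero]

/-- By the norm bound a zero of the denominator is also one of the numerator, which the determinant
forbids. -/
theorem denom_ne_zero (hdet : a * d - b * c ≠ 0)
    (hself : MapsTo (linFrac a b c d) (ball 0 1) (ball 0 1)) {z : ℂ}
    (hz : z ∈ closedBall (0 : ℂ) 1) : c * z + d ≠ 0 := by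
  intro h0
  have h1 := norm_num_le_norm_denom hdet hself hz
  rw [h0, norm_zero, norm_le_zero_iff] at h1
  refine hdet ?_
  by_cases hc : c = 0
  · simp [hc, show d = 0 by simpa [hc] using h0]
  · linear_combination a * h0 - c * h1

theorem denom_sub_ne_zero (hdet : a * d - b * c ≠ 0)
    (hself : MapsTo (linFrac a b c d) (ball 0 1) (ball 0 1)) {u z : ℂ}
    (hu : u ∈ ball (0 : ℂ) 1) (hz : z ∈ closedBall (0 : ℂ) 1) :
    c * z + d - conj u * (a * z + b) ≠ 0 := by
  intro h0
  have hu1 : ‖u‖ < 1 := by simpa using hu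
  have h1 := norm_num_le_norm_denom hdet hself hz
  have h2 : 0 < ‖c * z + d‖ := norm_pos_iff.2 (denom_ne_zero hdet hself hz)
  have h3 : ‖c * z + d‖ = ‖u‖ * ‖a * z + b‖ := by
    rw [sub_eq_zero.1 h0, norm_mul, RCLike.norm_conj]
  nlinarith [norm_nonneg u]

theorem linFracAdjoint_denom_ne_zero (hdet : a * d - b * c ≠ 0)
    (hself : MapsTo (linFrac a b c d) (ball 0 1) (ball 0 1)) {u : ℂ}
    (hu : u ∈ ball (0 : ℂ) 1) : d - conj u * b ≠ 0 := by
  simpa using denom_sub_ne_zero hdet hself hu (mem_closedBall_self zero_le_one)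

theorem conj_linFracAdjoint (u : ℂ) :
    conj (linFracAdjoint a b c d u) = (conj u * a - c) / (d - conj u * b) := by
  simp only [linFracAdjoint, linFrac, map_div₀, map_add, map_mul, map_neg, Complex.conj_conj]
  ring

theorem linFracAdjoint_mapsTo (hdet : a * d - b * c ≠ 0)
    (hself : MapsTo (linFrac a b c d) (ball 0 1) (ball 0 1)) :
    MapsTo (linFracAdjoint a b c d) (ball 0 1) (ball 0 1) := by
  intro u hu
  have hq := linFracAdjoint_denom_ne_zero hdet hself hu
  set p := linFracAdjoint a b c d u with hp
  rw [mem_ball_zero_iff]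
  by_contra! hp1
  have hp0 : conj p ≠ 0 := by
    exact (map_ne_zero (starRingEnd ℂ)).2 (norm_pos_iff.1 (one_pos.trans_le hp1))
  -- If `|p| ≥ 1`, the pole `1 / conj p` of `K_p` lies in the closed disc, and there `c z + d - conj
  -- u (a z + b)` would vanish.
  have hz : (conj p)⁻¹ ∈ closedBall (0 : ℂ) 1 := by
    rw [mem_closedBall_zero_iff, norm_inv, RCLike.norm_conj]
    exact inv_le_one_of_one_le₀ hp1
  refine denom_sub_ne_zero hdet hself hu hz ?_
  have h1 : conj p * (d - conj u * b) = conj u * a - c := by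
    rw [hp, conj_linFracAdjoint, div_mul_cancel₀ _ hq]
  have h2 := mul_inv_cancel₀ hp0
  linear_combination (conj p)⁻¹ * h1 - (d - conj u * b) * h2

theorem hardyKernel_linFracAdjoint_zero (hd : d ≠ 0) (z : ℂ) :
    hardyKernel (linFracAdjoint a b c d 0) z = d / (c * z + d) := by
  rw [hardyKernel, conj_linFracAdjoint]
  simp only [map_zero, zero_mul, zero_sub, sub_zero]
  rw [show 1 - -c / d * z = (c * z + d) / d by field_simp; ring, one_div_div]

/-- Common shape of the two Gram entries. If `p q = s t`, both sides are `0`. -/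
theorem div_mul_div_mul_one_div_one_sub {p q : ℂ} (hp : p ≠ 0) (hq : q ≠ 0) (x y s t : ℂ) :
    x / p * (y / q) * (1 / (1 - s / q * (t / p))) = x * y / (p * q - s * t) := by
  rw [show 1 - s / q * (t / p) = (p * q - s * t) / (p * q) by field_simp, one_div_div]
  field_simp

end HardyDisc

/-! ### Images of kernels under `W` and `W*`, and their Gram matrices. -/

namespace HardySpace

open HardyDisc

variable {a b c d : ℂ}

/-- After cancelling `c z + d`, both sides equal `d / (c z + d - conj u (a z + b))`; collecting
powers of `z` in this denominator produces `φ*(u)`. -/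
theorem weightedComposition_kernel (hdet : a * d - b * c ≠ 0)
    (hself : MapsTo (linFrac a b c d) (ball 0 1) (ball 0 1))
    {W : HardySpace →L[ℂ] HardySpace}
    (hW : IsWeightedComposition (hardyKernel (linFracAdjoint a b c d 0)) (linFrac a b c d) W)
    {u : ℂ} (hu : u ∈ ball (0 : ℂ) 1) :
    W (kernel u) = (d / (d - conj u * b)) • kernel (linFracAdjoint a b c d u) := by
  have hd : d ≠ 0 := by simpa using denom_ne_zero hdet hself (mem_closedBall_self zero_le_one)
  refine ext_ball fun z hz => ?_
  change W (kernel u) z = d / (d - conj u * b) * kernel (linFracAdjoint a b c d u) z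
  have hq := linFracAdjoint_denom_ne_zero hdet hself hu
  have hz' := ball_subset_closedBall hz
  have hden := denom_ne_zero hdet hself hz'
  rw [hW _ z hz, kernel_apply hu (hself hz), kernel_apply (linFracAdjoint_mapsTo hdet hself hu) hz,
    hardyKernel_linFracAdjoint_zero hd, hardyKernel, hardyKernel, conj_linFracAdjoint, linFrac]
  have h1 : 1 - conj u * ((a * z + b) / (c * z + d)) =
      (c * z + d - conj u * (a * z + b)) / (c * z + d) := by
    rw [eq_div_iff hden, sub_mul, mul_assoc, div_mul_cancel₀ _ hden, one_mul]
  have h2 : 1 - (conj u * a - c) / (d - conj u * b) * z =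
      (c * z + d - conj u * (a * z + b)) / (d - conj u * b) := by
    rw [eq_div_iff hq, sub_mul, mul_right_comm, div_mul_cancel₀ _ hq]
    ring
  rw [h1, h2, one_div_div, one_div_div, div_mul_div_cancel₀ hden, div_mul_div_cancel₀ hq]

theorem inner_weightedComposition_kernel (hdet : a * d - b * c ≠ 0)
    (hself : MapsTo (linFrac a b c d) (ball 0 1) (ball 0 1))
    {W : HardySpace →L[ℂ] HardySpace}
    (hW : IsWeightedComposition (hardyKernel (linFracAdjoint a b c d 0)) (linFrac a b c d) W)
    {u v : ℂ} (hu : u ∈ ball (0 : ℂ) 1) (hv : v ∈ ball (0 : ℂ) 1) :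
    inner ℂ (W (kernel u)) (W (kernel v)) = conj d * d /
      ((conj d - u * conj b) * (d - conj v * b) - (conj v * a - c) * (u * conj a - conj c)) := by
  have hp := linFracAdjoint_denom_ne_zero hdet hself hu
  have hq := linFracAdjoint_denom_ne_zero hdet hself hv
  have hp' : conj d - u * conj b ≠ 0 := by simpa using (map_ne_zero (starRingEnd ℂ)).2 hp
  have hpu : linFracAdjoint a b c d u = (u * conj a - conj c) / (conj d - u * conj b) := by
    simpa using congrArg conj (conj_linFracAdjoint (a := a) (b := b) (c := c) (d := d) u)
  have hmaps := linFracAdjoint_mapsTo hdet hself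
  rw [weightedComposition_kernel hdet hself hW hu, weightedComposition_kernel hdet hself hW hv,
    inner_smul_left, inner_smul_right, inner_kernel_kernel (hmaps hv) (hmaps hu), hardyKernel,
    conj_linFracAdjoint, hpu, ← mul_assoc, ← div_mul_div_mul_one_div_one_sub hp' hq]
  simp

open ContinuousLinearMap in
theorem inner_adjoint_kernel (hdet : a * d - b * c ≠ 0)
    (hself : MapsTo (linFrac a b c d) (ball 0 1) (ball 0 1))
    {W : HardySpace →L[ℂ] HardySpace}
    (hW : IsWeightedComposition (hardyKernel (linFracAdjoint a b c d 0)) (linFrac a b c d) W)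
    {u v : ℂ} (hu : u ∈ ball (0 : ℂ) 1) (hv : v ∈ ball (0 : ℂ) 1) :
    inner ℂ (adjoint W (kernel u)) (adjoint W (kernel v)) = d * conj d /
      ((c * u + d) * conj (c * v + d) - conj (a * v + b) * (a * u + b)) := by
  have hd : d ≠ 0 := by simpa using denom_ne_zero hdet hself (mem_closedBall_self zero_le_one)
  have hp := denom_ne_zero hdet hself (ball_subset_closedBall hu)
  have hq := (map_ne_zero (starRingEnd ℂ)).2 (denom_ne_zero hdet hself (ball_subset_closedBall hv))
  rw [adjoint_kernel hW hself hu, adjoint_kernel hW hself hv, inner_smul_left, inner_smul_right,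
    inner_kernel_kernel (hself hv) (hself hu), hardyKernel_linFracAdjoint_zero hd,
    hardyKernel_linFracAdjoint_zero hd, hardyKernel, Complex.conj_conj, ← mul_assoc,
    ← div_mul_div_mul_one_div_one_sub hp hq]
  simp only [linFrac, map_div₀]

end HardySpace

/-! ### The normality criterion. -/

open HardyDisc HardySpace in
theorem mainTheorem6 (a b c d η : ℂ) (hdet : a * d - b * c ≠ 0)
    (hself : IsHolomorphicSelfMap (linFrac a b c d))
    (hη : ‖η‖ = 1) (hfix : linFrac a b c d η = η) :
    ∃ W : HardySpace →L[ℂ] HardySpace,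
      IsWeightedComposition (hardyKernel (linFracAdjoint a b c d 0)) (linFrac a b c d) W ∧
        (IsStarNormal W ↔ ‖b‖ = ‖c‖) := by
  have hden {z : ℂ} (hz : z ∈ closedBall (0 : ℂ) 1) := denom_ne_zero hdet hself.2 hz
  have hd : d ≠ 0 := by simpa using hden (mem_closedBall_self zero_le_one)
  have hψ : DifferentiableOn ℂ (hardyKernel (linFracAdjoint a b c d 0)) (closedBall 0 1) := by
    refine DifferentiableOn.congr (f := fun z => d / (c * z + d)) ?_
      fun z _ => hardyKernel_linFracAdjoint_zero hd z
    exact DifferentiableOn.fun_div (by fun_prop) (by fun_prop) fun z hz => hden hz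
  obtain ⟨C, hC⟩ := (isCompact_closedBall (0 : ℂ) 1).exists_bound_of_continuousOn hψ.continuousOn
  obtain ⟨W, hW⟩ := exists_isWeightedComposition hself (hψ.mono ball_subset_closedBall)
    fun z hz => hC z (ball_subset_closedBall hz)
  refine ⟨W, hW, (isStarNormal_iff_kernel W).trans ⟨fun h => ?_, fun h u hu v hv => ?_⟩⟩
  -- At `u = v = 0` the denominators are `|d|² - |c|²` and `|d|² - |b|²`.
  · have h0 := mem_ball_self (x := (0 : ℂ)) one_pos
    have h1 := h 0 h0 0 h0
    rw [inner_weightedComposition_kernel hdet hself.2 hW h0 h0,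
      inner_adjoint_kernel hdet hself.2 hW h0 h0, mul_comm (conj d) d,
      div_eq_mul_inv, div_eq_mul_inv] at h1
    -- Inversion is injective even at `0`, so no nonvanishing of the denominators is needed.
    have h2 := inv_injective
      (mul_left_cancel₀ (mul_ne_zero hd ((map_ne_zero (starRingEnd ℂ)).2 hd)) h1)
    have h3 : conj b * b = conj c * c := by
      simp only [map_zero, zero_mul, mul_zero, sub_zero, zero_sub, zero_add] at h2
      linear_combination h2
    rw [Complex.conj_mul', Complex.conj_mul'] at h3
    exact (sq_eq_sq₀ (norm_nonneg _) (norm_nonneg _)).1 (by exact_mod_cast h3)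
  · rw [inner_weightedComposition_kernel hdet hself.2 hW hu hv,
      inner_adjoint_kernel hdet hself.2 hW hu hv, mul_comm (conj d) d]
    have hbc : conj b * b = conj c * c := by rw [Complex.conj_mul', Complex.conj_mul', h]
    have hηη : conj η * η = 1 := by rw [Complex.conj_mul', hη]; simp
    have hfix' : a * η + b = η * (c * η + d) := by
      rw [linFrac, div_eq_iff (hden (by simp [hη]))] at hfix
      exact hfix
    have had : a - d = c * η - b * conj η := by
      linear_combination conj η * hfix' - (a - d - c * η) * hηη
    have had' : conj a - conj d = conj c * conj η - conj b * η := by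
      simpa using congrArg conj had
    -- This is equality of the `conj v` coefficients. Substituting for `a - d` and its conjugate
    -- leaves `η (|c|² - |b|²) = 0`. Its conjugate `hrel'` handles the `u` coefficients.
    have hrel : conj a * b + a * conj c = b * conj d + conj c * d := by
      linear_combination b * had' + conj c * had - η * hbc
    have hrel' : a * conj b + conj a * c = conj b * d + c * conj d := by
      simpa using congrArg conj hrel
    congr 1
    simp only [map_add, map_mul]
    linear_combination (1 + u * conj v) * hbc + u * hrel' + conj v * hrel
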